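/- A \emph{radial weight} on $\mathbb C$ is a function $z\mapsto v(|z|)$, where $v:[0,\infty)\to(0,\infty)$ is continuous and increasing (not necessarily strictly) and $\log r=o(\log v(r))$ as $r\to\infty$. For a radial weight $v$ let $$H_v(\mathbb C)=\Big\{f:\mathbb C\to\mathbb C \text{ entire}:\ \|f\|_v:=\sup_{z\in\mathbb C}\frac{|f(z)|}{v(|z|)}<\infty\Big\},$$ normed by $\|\cdot\|_v$, and let $If(z)=\int_0^z f(\zeta)\,d\zeta$ be the integration operator. A radial weight $w$ is called a \emph{Clunie--Kővári weight} if $x\mapsto\log w(e^x)$ is convex on $\mathbb R$ and there is a nonnegative increasing function $\omega$ on $[1,\infty)$ with $$w(r)=w(1)\exp\int_1^r\frac{\omega(\rho)}{\rho}\,d\rho\quad(r\ge1)$$ and a constant $c>1$ such that $\omega(cr)-\omega(r)\ge1$ for all $r\ge1$. Let $w$ be a Clunie--Kővári weight and $v$ an arbitrary radial weight on $\mathbb C$. Then $I$ maps $H_w(\mathbb C)$ into $H_v(\mathbb C)$ and $I:H_w(\mathbb C)\to H_v(\mathbb C)$ is continuous (equivalently, bounded) if and only if $$\limsup_{r\to\infty}\frac1{v(r)}\int_0^r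 w(t)\,dt<\infty.$$ -/

import Mathlib

/-- A radial weight on `ℂ`, given by its radial profile `r ↦ v(r)` on `[0, ∞)`; the weight itself is
`z ↦ v(|z|)`. Values of `toFun` at negative reals play no role. -/
structure RadialWeight where
  /-- the radial profile -/
  toFun : ℝ → ℝ
  pos : ∀ r, 0 ≤ r → 0 < toFun r
  continuousOn : ContinuousOn toFun (Set.Ici 0)
  monotoneOn : MonotoneOn toFun (Set.Ici 0)
  log_isLittleO : (fun r => Real.log r) =o[Filter.atTop] (fun r => Real.log (toFun r))

namespace RadialWeight

instance : CoeFun RadialWeight (fun _ => ℝ → ℝ) := ⟨RadialWeight.toFun⟩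

theorem pos_norm (v : RadialWeight) (z : ℂ) : 0 < v ‖z‖ := v.pos _ (norm_nonneg z)

/-- The entire functions `f` with `sup_z |f(z)| / v(|z|) < ∞`, as a subspace of all functions. -/
def subspace (v : RadialWeight) : Submodule ℂ (ℂ → ℂ) where
  carrier := {f | Differentiable ℂ f ∧ BddAbove (Set.range fun z : ℂ => ‖f z‖ / v ‖z‖)}
  zero_mem' := ⟨differentiable_const 0, 0, by rintro _ ⟨z, rfl⟩; simp⟩
  add_mem' := by
    rintro f g ⟨hf, A, hA⟩ ⟨hg, B, hB⟩
    refine ⟨hf.add hg, A + B, ?_⟩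
    rintro _ ⟨z, rfl⟩
    have h1 : ‖f z‖ / v ‖z‖ ≤ A := hA ⟨z, rfl⟩
    have h2 : ‖g z‖ / v ‖z‖ ≤ B := hB ⟨z, rfl⟩
    have h3 : ‖(f + g) z‖ / v ‖z‖ ≤ (‖f z‖ + ‖g z‖) / v ‖z‖ :=
      div_le_div_of_nonneg_right (norm_add_le _ _) (v.pos_norm z).le
    rw [add_div] at h3
    exact h3.trans (add_le_add h1 h2)
  smul_mem' := by
    rintro a f ⟨hf, A, hA⟩
    refine ⟨hf.const_smul a, ‖a‖ * A, ?_⟩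
    rintro _ ⟨z, rfl⟩
    have h1 : ‖f z‖ / v ‖z‖ ≤ A := hA ⟨z, rfl⟩
    have h2 : ‖(a • f) z‖ / v ‖z‖ = ‖a‖ * (‖f z‖ / v ‖z‖) := by
      simp [mul_div_assoc]
    simp only [h2]
    exact mul_le_mul_of_nonneg_left h1 (norm_nonneg a)

/-- The space `H_v(ℂ)`. It is a type of its own, so that it carries the topology of `‖·‖_v` and not
the topology of pointwise convergence of `ℂ → ℂ`. -/
def H (v : RadialWeight) : Type := v.subspace

instance (v : RadialWeight) : AddCommGroup v.H := inferInstanceAs (AddCommGroup v.subspace)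

instance (v : RadialWeight) : Module ℂ v.H := inferInstanceAs (Module ℂ v.subspace)

instance (v : RadialWeight) : CoeFun v.H (fun _ => ℂ → ℂ) := ⟨Subtype.val⟩

/-- The norm `‖f‖_v = sup_z |f(z)| / v(|z|)` on `H_v(ℂ)`. -/
noncomputable instance (v : RadialWeight) : Norm v.H :=
  ⟨fun f => ⨆ z : ℂ, ‖f z‖ / v ‖z‖⟩

theorem norm_def (v : RadialWeight) (f : v.H) :
    ‖f‖ = ⨆ z : ℂ, ‖f z‖ / v ‖z‖ := rfl

theorem div_le_norm (v : RadialWeight) (f : v.H) (z : ℂ) :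
    ‖f z‖ / v ‖z‖ ≤ ‖f‖ := le_ciSup f.2.2 z

theorem normedSpaceCore (v : RadialWeight) : NormedSpace.Core ℂ v.H where
  norm_nonneg f := Real.iSup_nonneg fun z => div_nonneg (norm_nonneg _) (v.pos_norm z).le
  norm_smul a f := by
    rw [norm_def, norm_def, Real.mul_iSup_of_nonneg (norm_nonneg a)]
    refine iSup_congr fun z => ?_
    rw [← mul_div_assoc, ← norm_smul]
    rfl
  norm_triangle f g := by
    rw [norm_def]
    refine ciSup_le fun z => ?_
    have h3 : ‖(f + g : v.H) z‖ / v ‖z‖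
        ≤ (‖f z‖ + ‖g z‖) / v ‖z‖ :=
      div_le_div_of_nonneg_right (norm_add_le _ _) (v.pos_norm z).le
    rw [add_div] at h3
    exact h3.trans (add_le_add (v.div_le_norm f z) (v.div_le_norm g z))
  norm_eq_zero_iff f := by
    constructor
    · intro h
      refine Subtype.ext (funext fun z => ?_)
      have h1 := v.div_le_norm f z
      rw [h, div_le_iff₀ (v.pos_norm z), zero_mul] at h1
      exact norm_le_zero_iff.1 h1
    · rintro rfl
      have h0 : ∀ z : ℂ, (0 : v.H) z = 0 := fun _ => rfl
      simp [norm_def, h0]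

noncomputable instance (v : RadialWeight) : NormedAddCommGroup v.H :=
  NormedAddCommGroup.ofCore v.normedSpaceCore

noncomputable instance (v : RadialWeight) : NormedSpace ℂ v.H :=
  NormedSpace.ofCore v.normedSpaceCore

/-- `w` is log-convex: `x ↦ log w(eˣ)` is convex on `ℝ`. -/
def IsLogConvex (w : RadialWeight) : Prop :=
  ConvexOn ℝ Set.univ fun x : ℝ => Real.log (w (Real.exp x))

/-- Clunie–Kővári weights: log-convex radial weights `w` with
`w(r) = w(1) exp ∫₁ʳ ω(ρ)/ρ dρ` for `r ≥ 1`, where `ω ≥ 0` is increasing on `[1, ∞)` and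
`ω(cr) - ω(r) ≥ 1` for some `c > 1` and all `r ≥ 1`. -/
def IsClunieKovari (w : RadialWeight) : Prop :=
  w.IsLogConvex ∧
    ∃ ω : ℝ → ℝ, MonotoneOn ω (Set.Ici 1) ∧ (∀ r, 1 ≤ r → 0 ≤ ω r) ∧
      (∀ r, 1 ≤ r → w r = w 1 * Real.exp (∫ ρ in (1 : ℝ)..r, ω ρ / ρ)) ∧
      ∃ c : ℝ, 1 < c ∧ ∀ r, 1 ≤ r → 1 ≤ ω (c * r) - ω r

end RadialWeight

/-- The integral `∫₀ᶻ f(ζ) dζ` along the segment from `0` to `z`, parametrized as `ζ = t z`,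
`0 ≤ t ≤ 1` (for entire `f` any rectifiable path gives the same value). -/
noncomputable def integrationOperator (f : ℂ → ℂ) (z : ℂ) : ℂ :=
  ∫ t in (0 : ℝ)..1, f ((t : ℂ) * z) * z

/-!
`I` is bounded from `H_w` to `H_v` as soon as `∫₀ʳ w ≤ C v(r)` for all `r`, because
`|f(z)| ≤ ‖f‖_w w(|z|)`. Conversely, one function `f ∈ H_w` with `w ≤ Re f` near `∞` on the positive
axis is enough: then `∫_R^r w ≤ Re (If(r) - If(R))`, and the right-hand side is `O(v(r))`.

For a Clunie–Kővári weight such an `f` is a lacunary power series. Its monomials correspond to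
supporting lines of integer slopes of the convex function `L(y) = log w(e^y)`. The condition
`ω(cr) - ω(r) ≥ 1` says that `L(y + log c) - L(y) - y` increases, and this bounds the distance
between points of contact of consecutive slopes. Choosing each next line as the first one which is
`log 2` below `L` at the previous contact point, and vice versa, makes the terms of the series decay
geometrically away from the largest one, whereas the lines chosen still cover `L` up to a bounded
error.
-/

open Filter Set MeasureTheory

section Sequences

variable {u : ℕ → ℝ}

theorem sum_range_le_of_two_mul_le_succ {k : ℕ} (h₀ : 0 ≤ u 0)
    (hu : ∀ i < k, 2 * u i ≤ u (i + 1)) : ∑ i ∈ Finset.range k, u i ≤ u k := by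
  induction k with
  | zero => simpa using h₀
  | succ k ih =>
    rw [Finset.sum_range_succ]
    linarith [ih fun i hi => hu i (hi.trans k.lt_succ_self), hu k k.lt_succ_self]

theorem le_half_pow_mul_of_two_mul_succ_le (hu : ∀ i, 2 * u (i + 1) ≤ u i) (i : ℕ) :
    u i ≤ (1 / 2) ^ i * u 0 :=
  le_geom (by norm_num) i fun k _ => by linarith [hu k]

theorem summable_of_two_mul_succ_le (h₀ : ∀ i, 0 ≤ u i) (hu : ∀ i, 2 * u (i + 1) ≤ u i) :
    Summable u :=
  .of_nonneg_of_le h₀ (le_half_pow_mul_of_two_mul_succ_le hu)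
    (summable_geometric_two.mul_right (u 0))

theorem tsum_le_two_mul_of_two_mul_succ_le (h₀ : ∀ i, 0 ≤ u i)
    (hu : ∀ i, 2 * u (i + 1) ≤ u i) : ∑' i, u i ≤ 2 * u 0 :=
  hasSum_le (le_half_pow_mul_of_two_mul_succ_le hu) (summable_of_two_mul_succ_le h₀ hu).hasSum
    (hasSum_geometric_two.mul_right (u 0))

end Sequences

theorem two_mul_exp_le_exp {a b : ℝ} (h : a + Real.log 2 ≤ b) : 2 * Real.exp a ≤ Real.exp b := by
  rwa [← Real.exp_le_exp, Real.exp_add, Real.exp_log two_pos, mul_comm] at h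

theorem differentiable_tsum_mul_pow {ι : Type*} {c : ι → ℂ} {n : ι → ℕ}
    (hc : ∀ r : ℝ, 0 < r → Summable fun i => ‖c i‖ * r ^ n i) :
    Differentiable ℂ fun z : ℂ => ∑' i, c i * z ^ n i := by
  intro z
  have hz : z ∈ Metric.ball (0 : ℂ) (‖z‖ + 1) := by simp
  refine (Complex.differentiableOn_tsum_of_summable_norm (hc (‖z‖ + 1) (by positivity))
    (fun i => by fun_prop) Metric.isOpen_ball fun i y hy => ?_).differentiableAt
    (Metric.isOpen_ball.mem_nhds hz)
  rw [norm_mul, norm_pow]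
  gcongr
  exact (mem_ball_zero_iff.1 hy).le

theorem limsup_coe_lt_top_iff {α : Type*} {l : Filter α} {u : α → ℝ} :
    limsup (fun a => (u a : EReal)) l < ⊤ ↔ l.IsBoundedUnder (· ≤ ·) u := by
  constructor
  · intro h
    obtain ⟨M, hM, -⟩ := EReal.lt_iff_exists_real_btwn.1 h
    exact isBoundedUnder_of_eventually_le (a := M) <|
      (eventually_lt_of_limsup_lt hM).mono fun a ha => (EReal.coe_lt_coe_iff.1 ha).le
  · rintro ⟨M, hM⟩
    refine (limsup_le_of_le (a := (M : EReal)) (by isBoundedDefault) ?_).trans_lt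
      (EReal.coe_lt_top M)
    exact (eventually_map.1 hM).mono fun a ha => EReal.coe_le_coe_iff.2 ha

section IntegrationOperator

theorem integrationOperator_add {f g : ℂ → ℂ} (hf : Continuous f) (hg : Continuous g) (z : ℂ) :
    integrationOperator (f + g) z = integrationOperator f z + integrationOperator g z := by
  simp only [integrationOperator, Pi.add_apply, add_mul]
  exact intervalIntegral.integral_add (Continuous.intervalIntegrable (by fun_prop) _ _)
    (Continuous.intervalIntegrable (by fun_prop) _ _)

theorem integrationOperator_smul (a : ℂ) (f : ℂ → ℂ) (z : ℂ) :
    integrationOperator (a • f) z = a • integrationOperator f z := by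
  simp only [integrationOperator, Pi.smul_apply, smul_mul_assoc, intervalIntegral.integral_smul]

theorem integrationOperator_eq_sub {f F : ℂ → ℂ} (hF : ∀ z, HasDerivAt F (f z) z)
    (hf : Continuous f) (z : ℂ) : integrationOperator f z = F z - F 0 := by
  have hderiv (t : ℝ) : HasDerivAt (fun t : ℝ => F (t * z)) (f (t * z) * z) t := by
    have hline : HasDerivAt (fun t : ℝ => (t : ℂ) * z) z t := by
      simpa using (Complex.ofRealCLM.hasDerivAt (x := t)).mul_const z
    exact (hF _).comp t hline
  simpa [integrationOperator] using intervalIntegral.integral_eq_sub_of_hasDerivAt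
    (fun t _ => hderiv t) (Continuous.intervalIntegrable (by fun_prop) 0 1)

theorem differentiable_integrationOperator {f : ℂ → ℂ} (hf : Differentiable ℂ f) :
    Differentiable ℂ (integrationOperator f) := by
  obtain ⟨F, hF⟩ := hf.isExactOn_univ
  have hF' (z : ℂ) : HasDerivAt F (f z) z := hF z (mem_univ z)
  have hIf : integrationOperator f = fun z => F z - F 0 :=
    funext (integrationOperator_eq_sub hF' hf.continuous)
  rw [hIf]
  exact fun z => (hF' z).differentiableAt.sub_const (F 0)

theorem integrationOperator_ofReal (f : ℂ → ℂ) (r : ℝ) :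
    integrationOperator f r = ∫ t in (0 : ℝ)..r, f t := by
  have h := intervalIntegral.smul_integral_comp_mul_right (a := 0) (b := 1) (fun t : ℝ => f t) r
  rw [zero_mul, one_mul] at h
  rw [← h, integrationOperator, intervalIntegral.integral_mul_const, mul_comm,
    Complex.real_smul]
  simp only [Complex.ofReal_mul]

theorem integral_re_le_norm_add_norm {f : ℂ → ℂ} (hf : Continuous f) (a b : ℝ) :
    ∫ t in a..b, (f t).re ≤ ‖integrationOperator f b‖ + ‖integrationOperator f a‖ := by
  have hint (c d : ℝ) : IntervalIntegrable (fun t : ℝ => f t) volume c d :=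
    Continuous.intervalIntegrable (by fun_prop) c d
  calc ∫ t in a..b, (f t).re
    _ = (∫ t in a..b, f t).re := Complex.reCLM.intervalIntegral_comp_comm (hint a b)
    _ = (integrationOperator f b - integrationOperator f a).re := by
      rw [integrationOperator_ofReal, integrationOperator_ofReal,
        intervalIntegral.integral_interval_sub_left (hint 0 b) (hint 0 a)]
    _ ≤ ‖integrationOperator f b‖ + ‖integrationOperator f a‖ :=
      (Complex.re_le_norm _).trans (norm_sub_le _ _)

theorem norm_integrationOperator_le {f : ℂ → ℂ} {g : ℝ → ℝ} {z : ℂ}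
    (hfg : ∀ ζ, ‖f ζ‖ ≤ g ‖ζ‖) (hg : IntervalIntegrable g volume 0 ‖z‖) :
    ‖integrationOperator f z‖ ≤ ∫ t in (0 : ℝ)..‖z‖, g t := by
  have hscale := intervalIntegral.mul_integral_comp_mul_right (a := 0) (b := 1) (f := g) ‖z‖
  rw [zero_mul, one_mul, mul_comm, ← intervalIntegral.integral_mul_const] at hscale
  rw [← hscale]
  refine intervalIntegral.norm_integral_le_of_norm_le zero_le_one (ae_of_all _ fun t ht => ?_) ?_
  · have h := hfg (t * z)
    rw [norm_mul, Complex.norm_real, Real.norm_of_nonneg ht.1.le] at h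
    rw [norm_mul]
    gcongr
  · rcases eq_or_ne ‖z‖ 0 with hz | hz
    · simp [hz]
    · simpa [hz] using (hg.comp_mul_right (c := ‖z‖)).mul_const ‖z‖

end IntegrationOperator

namespace RadialWeight

theorem intervalIntegrable (w : RadialWeight) {a b : ℝ} (ha : 0 ≤ a) (hb : 0 ≤ b) :
    IntervalIntegrable w volume a b :=
  (w.continuousOn.mono fun _ ht => (le_inf ha hb).trans ht.1).intervalIntegrable

theorem monotoneOn_integral (w : RadialWeight) :
    MonotoneOn (fun r => ∫ t in (0 : ℝ)..r, w t) (Ici 0) := by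
  intro a ha b hb hab
  dsimp only
  rw [← sub_nonneg, intervalIntegral.integral_interval_sub_left (w.intervalIntegrable le_rfl hb)
    (w.intervalIntegrable le_rfl ha)]
  exact intervalIntegral.integral_nonneg hab fun t ht => (w.pos t (ha.trans ht.1)).le

theorem norm_apply_le (v : RadialWeight) (f : v.H) (z : ℂ) : ‖f z‖ ≤ ‖f‖ * v ‖z‖ :=
  (div_le_iff₀ (v.pos_norm z)).1 (v.div_le_norm f z)

theorem le_div_apply_zero_mul (v : RadialWeight) {a r : ℝ} (ha : 0 ≤ a) (hr : 0 ≤ r) :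
    a ≤ a / v 0 * v r := by
  have hv₀ := v.pos 0 le_rfl
  rw [div_mul_eq_mul_div, le_div_iff₀ hv₀]
  gcongr
  exact v.monotoneOn self_mem_Ici hr hr

theorem exists_forall_integral_le_of_isBoundedUnder {w v : RadialWeight}
    (h : atTop.IsBoundedUnder (· ≤ ·) fun r : ℝ => 1 / v r * ∫ t in (0 : ℝ)..r, w t) :
    ∃ C, ∀ r, 0 ≤ r → ∫ t in (0 : ℝ)..r, w t ≤ C * v r := by
  obtain ⟨M, hM⟩ := h
  obtain ⟨R, hR⟩ := eventually_atTop.1 (eventually_map.1 hM)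
  set J := ∫ t in (0 : ℝ)..max R 0, w t
  have hJ : 0 ≤ J := intervalIntegral.integral_nonneg (le_max_right R 0)
    fun t ht => (w.pos t ht.1).le
  refine ⟨max M (J / v 0), fun r hr => ?_⟩
  have hvr := v.pos r hr
  rcases le_total R r with hRr | hrR
  · have hMr := hR r hRr
    rw [one_div, inv_mul_eq_div, div_le_iff₀ hvr] at hMr
    exact hMr.trans (by gcongr; exact le_max_left _ _)
  · calc ∫ t in (0 : ℝ)..r, w t
      _ ≤ J := w.monotoneOn_integral hr (le_max_right R 0) (hrR.trans (le_max_left R 0))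
      _ ≤ J / v 0 * v r := v.le_div_apply_zero_mul hJ hr
      _ ≤ max M (J / v 0) * v r := by gcongr; exact le_max_right _ _

theorem exists_continuousLinearMap_of_integral_le {w v : RadialWeight} {C : ℝ}
    (hC : ∀ r, 0 ≤ r → ∫ t in (0 : ℝ)..r, w t ≤ C * v r) :
    ∃ T : w.H →L[ℂ] v.H, ∀ (f : w.H) (z : ℂ), T f z = integrationOperator f z := by
  have hbound (f : w.H) (z : ℂ) : ‖integrationOperator f z‖ / v ‖z‖ ≤ C * ‖f‖ := by
    rw [div_le_iff₀ (v.pos_norm z)]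
    calc ‖integrationOperator f z‖
      _ ≤ ∫ t in (0 : ℝ)..‖z‖, ‖f‖ * w t := norm_integrationOperator_le (w.norm_apply_le f)
          ((w.intervalIntegrable le_rfl (norm_nonneg z)).const_mul ‖f‖)
      _ = ‖f‖ * ∫ t in (0 : ℝ)..‖z‖, w t := intervalIntegral.integral_const_mul _ _
      _ ≤ ‖f‖ * (C * v ‖z‖) := by gcongr; exact hC _ (norm_nonneg z)
      _ = C * ‖f‖ * v ‖z‖ := by ring
  let T : w.H →ₗ[ℂ] v.H :=
    { toFun := fun f => ⟨integrationOperator f, differentiable_integrationOperator f.2.1,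
        C * ‖f‖, forall_mem_range.2 (hbound f)⟩
      map_add' := fun f g => Subtype.ext <| funext <|
        integrationOperator_add f.2.1.continuous g.2.1.continuous
      map_smul' := fun a f => Subtype.ext <| funext <| integrationOperator_smul a f }
  exact ⟨T.mkContinuous C fun f => ciSup_le (hbound f), fun _ _ => rfl⟩

theorem isBoundedUnder_of_le_re {w v : RadialWeight} {f : ℂ → ℂ} {F : v.H} (hf : Continuous f)
    (hwf : ∀ᶠ r : ℝ in atTop, w r ≤ (f r).re) (hF : ∀ z, F z = integrationOperator f z) :
    atTop.IsBoundedUnder (· ≤ ·) fun r : ℝ => 1 / v r * ∫ t in (0 : ℝ)..r, w t := by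
  obtain ⟨R, hR⟩ := eventually_atTop.1 (hwf.and (eventually_ge_atTop 0))
  have hR₀ : 0 ≤ R := (hR R le_rfl).2
  set J := ∫ t in (0 : ℝ)..R, w t
  have hJ : 0 ≤ J := intervalIntegral.integral_nonneg hR₀ fun t ht => (w.pos t ht.1).le
  refine isBoundedUnder_of_eventually_le (a := J / v 0 + 2 * ‖F‖) ?_
  filter_upwards [eventually_ge_atTop R] with r hr
  have hr₀ : 0 ≤ r := hR₀.trans hr
  have hF_le {s : ℝ} (hs : 0 ≤ s) (hsr : s ≤ r) : ‖integrationOperator f s‖ ≤ ‖F‖ * v r := by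
    have h := v.norm_apply_le F s
    rw [hF, Complex.norm_real, Real.norm_of_nonneg hs] at h
    exact h.trans (by gcongr; exact v.monotoneOn hs hr₀ hsr)
  rw [one_div, inv_mul_eq_div, div_le_iff₀ (v.pos r hr₀)]
  calc ∫ t in (0 : ℝ)..r, w t
    _ = J + ∫ t in R..r, w t := (intervalIntegral.integral_add_adjacent_intervals
        (w.intervalIntegrable le_rfl hR₀) (w.intervalIntegrable hR₀ hr₀)).symm
    _ ≤ J + ∫ t in R..r, (f t).re := by
      gcongr
      exact intervalIntegral.integral_mono_on hr (w.intervalIntegrable hR₀ hr₀)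
        (Continuous.intervalIntegrable (by fun_prop) R r) fun t ht => (hR t ht.1).1
    _ ≤ J / v 0 * v r + (‖F‖ * v r + ‖F‖ * v r) := by
      gcongr
      · exact v.le_div_apply_zero_mul hJ hr₀
      · exact (integral_re_le_norm_add_norm hf R r).trans
          (add_le_add (hF_le hr₀ le_rfl) (hF_le hR₀ hr))
    _ = (J / v 0 + 2 * ‖F‖) * v r := by ring

end RadialWeight

section Contact

variable {L : ℝ → ℝ}

theorem monotoneOn_Ici_of_isMinOn {x : ℝ} (hL : ConvexOn ℝ univ L) (hx : IsMinOn L univ x) :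
    MonotoneOn L (Ici x) := fun _ hy z _ hyz =>
  (hL.le_max_of_mem_Icc (mem_univ x) (mem_univ z) ⟨hy, hyz⟩).trans
    (max_le (hx (mem_univ z)) le_rfl)

theorem antitoneOn_Iic_of_isMinOn {x : ℝ} (hL : ConvexOn ℝ univ L) (hx : IsMinOn L univ x) :
    AntitoneOn L (Iic x) := fun y _ _ hz hyz =>
  (hL.le_max_of_mem_Icc (mem_univ y) (mem_univ x) ⟨hyz, hz⟩).trans
    (max_le le_rfl (hx (mem_univ y)))

theorem le_of_isMinOn_sub_mul {x y s t : ℝ} (hst : s < t)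
    (hx : IsMinOn (fun z => L z - s * z) univ x) (hy : IsMinOn (fun z => L z - t * z) univ y) :
    x ≤ y := by
  have hxy := isMinOn_univ_iff.1 hx y
  have hyx := isMinOn_univ_iff.1 hy x
  by_contra! h
  nlinarith [mul_pos (sub_pos.2 hst) (sub_pos.2 h)]

theorem tendsto_atTop_of_isMinOn_sub_mul {x : ℕ → ℝ} {m : ℝ}
    (hx : ∀ n : ℕ, IsMinOn (fun y => L y - (n + m) * y) univ (x n)) :
    Tendsto x atTop atTop := by
  refine tendsto_atTop.2 fun X => ?_
  filter_upwards [tendsto_natCast_atTop_atTop.eventually_gt_atTop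
    (L (X + 1) - m * (X + 1) - (L (x 0) - m * x 0))] with n hn
  by_contra! hX
  have hn_min := isMinOn_univ_iff.1 (hx n) (X + 1)
  have h₀_min := isMinOn_univ_iff.1 (hx 0) (x n)
  rw [Nat.cast_zero, zero_add] at h₀_min
  nlinarith [mul_nonneg n.cast_nonneg (sub_nonneg.2 hX.le)]

theorem tendsto_sub_mul_atTop_of_isLittleO {ℓ : ℝ} (hℓ : ∀ y, ℓ ≤ L y)
    (hL : (fun y => y) =o[atTop] L) (a : ℝ) : Tendsto (fun y => L y - a * y) atTop atTop := by
  refine tendsto_atTop_mono' atTop ?_ tendsto_id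
  have hpos : 0 < 1 / (|a| + 1) := by positivity
  filter_upwards [Asymptotics.isLittleO_iff.1 hL hpos, eventually_gt_atTop |ℓ|] with y hy hyℓ
  have hy₀ : 0 < y := (abs_nonneg ℓ).trans_lt hyℓ
  rw [Real.norm_of_nonneg hy₀.le, Real.norm_eq_abs, one_div, inv_mul_eq_div,
    le_div_iff₀ (by positivity)] at hy
  have hLy : 0 ≤ L y := by
    by_contra! h
    rw [abs_of_neg h] at hy
    nlinarith [hℓ y, neg_abs_le ℓ, mul_nonneg hy₀.le (abs_nonneg a)]
  rw [abs_of_nonneg hLy] at hy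
  simp only [id]
  nlinarith [le_abs_self a]

theorem exists_isMinOn_sub_mul (hc : Continuous L) {ℓ : ℝ} (hℓ : ∀ y, ℓ ≤ L y) {a : ℝ}
    (ha : 0 < a) (hL : Tendsto (fun y => L y - a * y) atTop atTop) :
    ∃ x, IsMinOn (fun y => L y - a * y) univ x := by
  simp only [isMinOn_univ_iff]
  refine Continuous.exists_forall_le (by fun_prop) ?_
  rw [cocompact_eq_atBot_atTop, tendsto_sup]
  refine ⟨tendsto_atTop_mono (f := fun y => ℓ + -(a * y)) (fun y => ?_) ?_, hL⟩
  · linarith [hℓ y]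
  · exact tendsto_atTop_add_const_left _ ℓ
      (tendsto_neg_atBot_atTop.comp (tendsto_id.const_mul_atBot ha))

theorem contact_le_add_two_mul {d a b s : ℝ} (hd : 0 ≤ d) (ha₀ : 0 ≤ a)
    (hmono : MonotoneOn (fun y => L (y + d) - L y - y) (Ici 0))
    (ha : IsMinOn (fun y => L y - s * y) univ a)
    (hb : IsMinOn (fun y => L y - (s + 1) * y) univ b) : b ≤ a + 2 * d := by
  by_contra! hab
  have h₁ : L (a + d) - L a - a ≤ L (b - 2 * d + d) - L (b - 2 * d) - (b - 2 * d) :=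
    hmono (mem_Ici.2 ha₀) (mem_Ici.2 (by linarith)) (by linarith)
  have h₂ : L (a + d + d) - L (a + d) - (a + d) ≤ L (b - d + d) - L (b - d) - (b - d) :=
    hmono (mem_Ici.2 (by linarith)) (mem_Ici.2 (by linarith)) (by linarith)
  have ha' := isMinOn_univ_iff.1 ha (b - 2 * d)
  have hb' := isMinOn_univ_iff.1 hb (a + d + d)
  rw [show b - 2 * d + d = b - d by ring] at h₁
  rw [sub_add_cancel] at h₂
  linarith

end Contact

/-- Supporting lines of the consecutive integer slopes `m, m + 1, …` of the graph of a convex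
function `L`, the `n`-th one touching it at the abscissa `x n`; consecutive abscissae are at most
`D` apart. Exponentiated and read in the variable `r = e^y`, they become the monomials from which
a power series comparable to `e^L` is built. -/
structure SupportingLines (L : ℝ → ℝ) where
  m : ℕ
  x : ℕ → ℝ
  D : ℝ
  convexOn : ConvexOn ℝ univ L
  isMinOn : ∀ n : ℕ, IsMinOn (fun y => L y - ((n : ℝ) + m) * y) univ (x n)
  x_succ_le : ∀ n, x (n + 1) ≤ x n + D

theorem SupportingLines.nonempty_of_monotoneOn {L : ℝ → ℝ} (hL : ConvexOn ℝ univ L) {ℓ : ℝ}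
    (hℓ : ∀ y, ℓ ≤ L y) (hlin : (fun y => y) =o[atTop] L) {d : ℝ} (hd : 0 ≤ d)
    (hmono : MonotoneOn (fun y => L (y + d) - L y - y) (Ici 0)) :
    Nonempty (SupportingLines L) := by
  have hc : Continuous L := continuousOn_univ.1 (hL.continuousOn isOpen_univ)
  choose x hx using fun n : ℕ => exists_isMinOn_sub_mul hc hℓ (a := n + 1) (by positivity)
    (tendsto_sub_mul_atTop_of_isLittleO hℓ hlin _)
  obtain ⟨p, hp⟩ := eventually_atTop.1
    ((tendsto_atTop_of_isMinOn_sub_mul hx).eventually_ge_atTop 0)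
  refine ⟨⟨p + 1, fun n => x (n + p), 2 * d, hL, fun n => ?_, fun n => ?_⟩⟩
  · convert hx (n + p) using 4
    push_cast
    ring
  · refine contact_le_add_two_mul hd (hp _ (Nat.le_add_left p n)) hmono (hx (n + p)) ?_
    convert hx (n + 1 + p) using 4
    push_cast
    ring

namespace SupportingLines

variable {L : ℝ → ℝ} (S : SupportingLines L)

theorem monotone_x : Monotone S.x :=
  monotone_nat_of_le_succ fun n => le_of_isMinOn_sub_mul (by push_cast; linarith)
    (S.isMinOn n) (S.isMinOn (n + 1))

theorem tendsto_x : Tendsto S.x atTop atTop := tendsto_atTop_of_isMinOn_sub_mul S.isMinOn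

/-- The supporting line of slope `n + m`, as an affine function. -/
def line (n : ℕ) (y : ℝ) : ℝ := L (S.x n) + ((n : ℝ) + S.m) * (y - S.x n)

theorem line_x (n : ℕ) : S.line n (S.x n) = L (S.x n) := by simp [line]

theorem line_le (n : ℕ) (y : ℝ) : S.line n y ≤ L y := by
  have h := isMinOn_univ_iff.1 (S.isMinOn n) y
  rw [line]
  linarith

theorem monotone_line_sub_line {a b : ℕ} (hab : a ≤ b) :
    Monotone fun y => S.line b y - S.line a y := by
  intro y z hyz
  have h := mul_le_mul_of_nonneg_right (Nat.cast_le (α := ℝ).2 hab) (sub_nonneg.2 hyz)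
  simp only [line]
  linarith

theorem line_succ_sub_line_le (n : ℕ) (y : ℝ) :
    S.line (n + 1) y - S.line n y ≤ y - S.x n := by
  have h := S.line_le (n + 1) (S.x n)
  simp only [line, Nat.cast_add, Nat.cast_one] at h ⊢
  linarith

theorem line_sub_line_succ_le (n : ℕ) (y : ℝ) :
    S.line n y - S.line (n + 1) y ≤ S.x (n + 1) - y := by
  have h := S.line_le n (S.x (n + 1))
  simp only [line, Nat.cast_add, Nat.cast_one] at h ⊢
  linarith

theorem sub_x_succ_le_sub_line (n : ℕ) (y : ℝ) : y - S.x (n + 1) ≤ L y - S.line n y := by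
  linarith [S.line_sub_line_succ_le n y, S.line_le (n + 1) y]

theorem x_sub_le_sub_line_succ (n : ℕ) (y : ℝ) : S.x n - y ≤ L y - S.line (n + 1) y := by
  linarith [S.line_succ_sub_line_le n y, S.line_le n y]

theorem convexOn_sub_line (n : ℕ) : ConvexOn ℝ univ fun y => L y - S.line n y := by
  have hlinear := (LinearMap.mulLeft ℝ ((n : ℝ) + S.m)).concaveOn convex_univ
  refine ((S.convexOn.sub hlinear).add_const (((n : ℝ) + S.m) * S.x n - L (S.x n))).congr
    fun y _ => ?_
  simp only [line, Pi.add_apply, Pi.sub_apply, LinearMap.mulLeft_apply]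
  ring

theorem isMinOn_sub_line (n : ℕ) : IsMinOn (fun y => L y - S.line n y) univ (S.x n) :=
  isMinOn_univ_iff.2 fun y => by simpa [S.line_x] using S.line_le n y

theorem monotoneOn_sub_line (n : ℕ) : MonotoneOn (fun y => L y - S.line n y) (Ici (S.x n)) :=
  monotoneOn_Ici_of_isMinOn (S.convexOn_sub_line n) (S.isMinOn_sub_line n)

theorem antitoneOn_sub_line (n : ℕ) : AntitoneOn (fun y => L y - S.line n y) (Iic (S.x n)) :=
  antitoneOn_Iic_of_isMinOn (S.convexOn_sub_line n) (S.isMinOn_sub_line n)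

theorem le_line_succ_add {n : ℕ} {y : ℝ} (hy : y ∈ Icc (S.x n) (S.x (n + 1))) :
    L y ≤ S.line (n + 1) y + S.D := by
  have h := S.antitoneOn_sub_line (n + 1) (hy.1.trans hy.2) hy.2 hy.1
  linarith [S.line_sub_line_succ_le n (S.x n), S.line_x n, S.x_succ_le n]

/-- At each other's points of contact, the lines `a` and `b` lie at least `log 2` below `L`, so that
their exponentials are there at most half of `e^L`. -/
def Separated (a b : ℕ) : Prop :=
  S.line a (S.x b) + Real.log 2 ≤ L (S.x b) ∧ S.line b (S.x a) + Real.log 2 ≤ L (S.x a)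

theorem exists_separated (a : ℕ) : ∃ b, a < b ∧ S.Separated a b := by
  obtain ⟨b, hab, hb⟩ := ((eventually_gt_atTop a).and
    (S.tendsto_x.eventually_ge_atTop (S.x (a + 1) + Real.log 2))).exists
  refine ⟨b + 1, by omega, ?_, ?_⟩
  · linarith [S.sub_x_succ_le_sub_line a (S.x (b + 1)), S.monotone_x b.le_succ]
  · linarith [S.x_sub_le_sub_line_succ b (S.x a), S.monotone_x a.le_succ]

/-- `L` stays within a bounded distance of the upper envelope of the lines `a` and `b` between
their points of contact. -/
def Covers (a b : ℕ) : Prop :=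
  ∀ y ∈ Icc (S.x a) (S.x b),
    L y ≤ max (S.line a y) (S.line b y) + (2 * Real.log 2 + 2 * S.D)

theorem D_nonneg : 0 ≤ S.D := by linarith [S.x_succ_le 0, S.monotone_x (Nat.zero_le 1)]

theorem covers_succ_of_line_left_close {a b : ℕ} (hab : a ≤ b)
    (h : L (S.x b) ≤ S.line a (S.x b) + Real.log 2) : S.Covers a (b + 1) := by
  intro y hy
  have hlog : 0 < Real.log 2 := Real.log_pos one_lt_two
  have hD := S.D_nonneg
  rcases le_total (S.x b) y with hby | hyb
  · linarith [S.le_line_succ_add ⟨hby, hy.2⟩, le_max_right (S.line a y) (S.line (b + 1) y)]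
  · have hgap := S.monotoneOn_sub_line a hy.1 (S.monotone_x hab) hyb
    linarith [le_max_left (S.line a y) (S.line (b + 1) y)]

theorem covers_succ_of_line_right_close {a b : ℕ} (hab : a < b)
    (h : L (S.x a) ≤ S.line b (S.x a) + Real.log 2) : S.Covers a (b + 1) := by
  intro y hy
  have hlog : 0 < Real.log 2 := Real.log_pos one_lt_two
  have hD := S.D_nonneg
  have hmax := le_max_right (S.line a y) (S.line (b + 1) y)
  rcases le_total (S.x b) y with hby | hyb
  · linarith [S.le_line_succ_add ⟨hby, hy.2⟩]
  · have hgap := S.antitoneOn_sub_line b (hy.1.trans hyb) hyb hy.1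
    obtain ⟨k, rfl⟩ := Nat.exists_eq_succ_of_ne_zero hab.ne_bot
    -- The steep line `k + 1` can only come this close at `x a` if `x a` is near its contact point.
    have hshort : S.x k - S.x a ≤ Real.log 2 := by
      linarith [S.x_sub_le_sub_line_succ k (S.x a)]
    linarith [S.line_sub_line_succ_le (k + 1) y, S.x_succ_le k, S.x_succ_le (k + 1), hy.1]

theorem exists_separated_covers (a : ℕ) : ∃ b, a < b ∧ S.Separated a b ∧ S.Covers a b := by
  classical
  obtain ⟨hab, hsep⟩ := Nat.find_spec (S.exists_separated a)
  refine ⟨_, hab, hsep, ?_⟩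
  obtain ⟨b, hb⟩ := Nat.exists_eq_succ_of_ne_zero hab.ne_bot
  rw [hb] at hab ⊢
  rcases (Nat.le_of_lt_succ hab).eq_or_lt with rfl | hab'
  · exact S.covers_succ_of_line_left_close le_rfl
      (by linarith [S.line_x a, Real.log_pos one_lt_two])
  have hnot : ¬S.Separated a b := fun h =>
    Nat.find_min (S.exists_separated a) (m := b) (by omega) ⟨hab', h⟩
  rw [Separated, not_and_or, not_le, not_le] at hnot
  exact hnot.elim (fun h => S.covers_succ_of_line_left_close hab'.le h.le)
    (fun h => S.covers_succ_of_line_right_close hab' h.le)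

/-- Indices of a subsequence of lines whose neighbours are separated, yet still cover `L`. -/
noncomputable def chain : ℕ → ℕ
  | 0 => 0
  | k + 1 => (S.exists_separated_covers (chain k)).choose

theorem chain_lt_chain_succ (k : ℕ) : S.chain k < S.chain (k + 1) :=
  (S.exists_separated_covers (S.chain k)).choose_spec.1

theorem separated_chain (k : ℕ) : S.Separated (S.chain k) (S.chain (k + 1)) :=
  (S.exists_separated_covers (S.chain k)).choose_spec.2.1

theorem covers_chain (k : ℕ) : S.Covers (S.chain k) (S.chain (k + 1)) :=
  (S.exists_separated_covers (S.chain k)).choose_spec.2.2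

theorem monotone_x_chain : Monotone fun k => S.x (S.chain k) :=
  S.monotone_x.comp (strictMono_nat_of_lt_succ S.chain_lt_chain_succ).monotone

theorem tendsto_x_chain : Tendsto (fun k => S.x (S.chain k)) atTop atTop :=
  S.tendsto_x.comp (strictMono_nat_of_lt_succ S.chain_lt_chain_succ).tendsto_atTop

theorem exists_mem_Icc_x_chain {y : ℝ} (hy : S.x 0 ≤ y) :
    ∃ k, y ∈ Icc (S.x (S.chain k)) (S.x (S.chain (k + 1))) := by
  classical
  have hex : ∃ k, y < S.x (S.chain k) := (S.tendsto_x_chain.eventually_gt_atTop y).exists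
  have hne : Nat.find hex ≠ 0 := fun h => (h ▸ Nat.find_spec hex).not_ge hy
  obtain ⟨k, hk⟩ := Nat.exists_eq_succ_of_ne_zero hne
  exact ⟨k, not_lt.1 (Nat.find_min hex (by omega)), (hk ▸ Nat.find_spec hex).le⟩

/-- The exponential of the `k`-th line of the chain. -/
noncomputable def term (k : ℕ) (y : ℝ) : ℝ := Real.exp (S.line (S.chain k) y)

theorem term_nonneg (k : ℕ) (y : ℝ) : 0 ≤ S.term k y := (Real.exp_pos _).le

theorem term_le (k : ℕ) (y : ℝ) : S.term k y ≤ Real.exp (L y) :=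
  Real.exp_le_exp.2 (S.line_le _ _)

theorem two_mul_term_le_succ {k : ℕ} {y : ℝ} (hy : S.x (S.chain (k + 1)) ≤ y) :
    2 * S.term k y ≤ S.term (k + 1) y :=
  two_mul_exp_le_exp <| by
    linarith [S.monotone_line_sub_line (S.chain_lt_chain_succ k).le hy, (S.separated_chain k).1,
      S.line_x (S.chain (k + 1))]

theorem two_mul_term_succ_le {k : ℕ} {y : ℝ} (hy : y ≤ S.x (S.chain k)) :
    2 * S.term (k + 1) y ≤ S.term k y :=
  two_mul_exp_le_exp <| by
    linarith [S.monotone_line_sub_line (S.chain_lt_chain_succ k).le hy, (S.separated_chain k).2,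
      S.line_x (S.chain k)]

theorem sum_range_term_le {k : ℕ} {y : ℝ} (hy : S.x (S.chain k) ≤ y) :
    ∑ i ∈ Finset.range k, S.term i y ≤ S.term k y :=
  sum_range_le_of_two_mul_le_succ (S.term_nonneg 0 y) fun _ hi =>
    S.two_mul_term_le_succ ((S.monotone_x_chain hi).trans hy)

theorem two_mul_term_succ_add_le {k : ℕ} {y : ℝ} (hy : y ≤ S.x (S.chain k)) (i : ℕ) :
    2 * S.term (i + 1 + k) y ≤ S.term (i + k) y := by
  rw [add_right_comm]
  exact S.two_mul_term_succ_le (hy.trans (S.monotone_x_chain (Nat.le_add_left k i)))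

theorem tsum_term_add_le {k : ℕ} {y : ℝ} (hy : y ≤ S.x (S.chain k)) :
    ∑' i, S.term (i + k) y ≤ 2 * S.term k y := by
  simpa using tsum_le_two_mul_of_two_mul_succ_le (fun i => S.term_nonneg (i + k) y)
    (S.two_mul_term_succ_add_le hy)

theorem summable_term (y : ℝ) : Summable fun k => S.term k y := by
  obtain ⟨k, hk⟩ := (S.tendsto_x_chain.eventually_ge_atTop y).exists
  exact (summable_nat_add_iff k).1 <|
    summable_of_two_mul_succ_le (fun i => S.term_nonneg (i + k) y) (S.two_mul_term_succ_add_le hk)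

theorem tsum_term_le (y : ℝ) : ∑' k, S.term k y ≤ 4 * Real.exp (L y) := by
  rcases le_total y (S.x 0) with hy | hy
  · have h := S.tsum_term_add_le (k := 0) hy
    simp only [add_zero] at h
    linarith [S.term_le 0 y, Real.exp_pos (L y)]
  · obtain ⟨k, hk, hk'⟩ := S.exists_mem_Icc_x_chain hy
    rw [← (S.summable_term y).sum_add_tsum_nat_add (k + 1), Finset.sum_range_succ]
    linarith [S.sum_range_term_le hk, S.tsum_term_add_le hk', S.term_le k y, S.term_le (k + 1) y]

theorem exp_le_mul_tsum_term {y : ℝ} (hy : S.x 0 ≤ y) :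
    Real.exp (L y) ≤ Real.exp (2 * Real.log 2 + 2 * S.D) * ∑' k, S.term k y := by
  have hterm (j : ℕ) : S.term j y ≤ ∑' k, S.term k y :=
    (S.summable_term y).le_tsum j fun i _ => S.term_nonneg i y
  obtain ⟨k, hk⟩ := S.exists_mem_Icc_x_chain hy
  calc Real.exp (L y)
    _ ≤ Real.exp (max (S.line (S.chain k) y) (S.line (S.chain (k + 1)) y)
          + (2 * Real.log 2 + 2 * S.D)) := Real.exp_le_exp.2 (S.covers_chain k y hk)
    _ = Real.exp (2 * Real.log 2 + 2 * S.D) * max (S.term k y) (S.term (k + 1) y) := by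
      rw [add_comm, Real.exp_add, Real.exp_monotone.map_max, term, term]
    _ ≤ Real.exp (2 * Real.log 2 + 2 * S.D) * ∑' k, S.term k y := by
      gcongr
      exact max_le (hterm k) (hterm (k + 1))

/-- The lacunary power series whose `k`-th monomial is, at `e^y`, the `k`-th term of the chain. -/
noncomputable def lacunarySeries (z : ℂ) : ℂ :=
  ∑' k, (Real.exp (S.line (S.chain k) 0) : ℂ) * z ^ (S.chain k + S.m)

theorem exp_line_zero_mul_pow {r : ℝ} (hr : 0 < r) (k : ℕ) :
    Real.exp (S.line (S.chain k) 0) * r ^ (S.chain k + S.m) = S.term k (Real.log r) := by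
  nth_rw 1 [term, ← Real.exp_log hr]
  rw [← Real.exp_nat_mul, ← Real.exp_add]
  simp only [line, Nat.cast_add]
  congr 1
  ring

theorem norm_monomial {z : ℂ} (hz : z ≠ 0) (k : ℕ) :
    ‖(Real.exp (S.line (S.chain k) 0) : ℂ) * z ^ (S.chain k + S.m)‖ =
      S.term k (Real.log ‖z‖) := by
  rw [norm_mul, norm_pow, Complex.norm_real, Real.norm_of_nonneg (Real.exp_pos _).le,
    S.exp_line_zero_mul_pow (norm_pos_iff.2 hz)]

theorem norm_lacunarySeries_le {z : ℂ} (hz : z ≠ 0) :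
    ‖S.lacunarySeries z‖ ≤ 4 * Real.exp (L (Real.log ‖z‖)) :=
  (tsum_of_norm_bounded (S.summable_term _).hasSum fun k => (S.norm_monomial hz k).le).trans
    (S.tsum_term_le _)

theorem re_lacunarySeries {r : ℝ} (hr : 0 < r) :
    (S.lacunarySeries r).re = ∑' k, S.term k (Real.log r) := by
  simp only [lacunarySeries, ← Complex.ofReal_pow, ← Complex.ofReal_mul, ← Complex.ofReal_tsum,
    Complex.ofReal_re, S.exp_line_zero_mul_pow hr]

theorem differentiable_lacunarySeries : Differentiable ℂ S.lacunarySeries :=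
  differentiable_tsum_mul_pow fun r hr => by
    simpa only [Complex.norm_real, Real.norm_of_nonneg (Real.exp_pos _).le,
      S.exp_line_zero_mul_pow hr] using S.summable_term (Real.log r)

end SupportingLines

section LogarithmicIntegral

variable {ω : ℝ → ℝ} {a b c : ℝ}

theorem intervalIntegrable_div_id_of_monotoneOn (hω : MonotoneOn ω (uIcc a b))
    (h₀ : (0 : ℝ) ∉ uIcc a b) : IntervalIntegrable (fun ρ => ω ρ / ρ) volume a b := by
  simp only [div_eq_mul_inv]
  exact hω.intervalIntegrable.mul_continuousOn <|
    continuousOn_id.inv₀ fun _ ht h => h₀ (h ▸ ht)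

theorem integral_div_id_scale (hc : c ≠ 0) :
    ∫ ρ in c * a..c * b, ω ρ / ρ = ∫ t in a..b, ω (c * t) / t := by
  rw [← intervalIntegral.mul_integral_comp_mul_left, ← intervalIntegral.integral_const_mul]
  simp only [mul_div_assoc', mul_div_mul_left _ _ hc]

theorem integral_div_id_add_log_le (hω : MonotoneOn ω (Ici 1)) (hc : 1 < c)
    (hωc : ∀ r, 1 ≤ r → 1 ≤ ω (c * r) - ω r) (ha : 1 ≤ a) (hab : a ≤ b) :
    (∫ ρ in a..b, ω ρ / ρ) + (Real.log b - Real.log a) ≤ ∫ ρ in c * a..c * b, ω ρ / ρ := by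
  have hIcc : Icc a b ⊆ Ici 1 := fun t ht => ha.trans ht.1
  have hpos {t : ℝ} (ht : t ∈ Icc a b) : 0 < t := one_pos.trans_le (hIcc ht)
  have hint {φ : ℝ → ℝ} (hφ : MonotoneOn φ (Icc a b)) :
      IntervalIntegrable (fun ρ => φ ρ / ρ) volume a b := by
    rw [← uIcc_of_le hab] at hφ
    exact intervalIntegrable_div_id_of_monotoneOn hφ
      fun h => (hpos (uIcc_of_le hab ▸ h)).false
  have hωab : MonotoneOn ω (Icc a b) := hω.mono hIcc
  have hωc_mono : MonotoneOn (fun t => ω (c * t)) (Icc a b) := fun s hs t ht hst =>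
    hω (one_le_mul_of_one_le_of_one_le hc.le (hIcc hs))
      (one_le_mul_of_one_le_of_one_le hc.le (hIcc ht)) (by gcongr)
  have hlog : Real.log b - Real.log a = ∫ ρ in a..b, 1 / ρ := by
    rw [integral_one_div_of_pos (by linarith) (by linarith), Real.log_div (by linarith)
      (by linarith)]
  rw [hlog, ← intervalIntegral.integral_add (hint hωab) (hint monotoneOn_const),
    integral_div_id_scale (by linarith)]
  refine intervalIntegral.integral_mono_on hab ((hint hωab).add (hint monotoneOn_const))
    (hint hωc_mono) fun t ht => ?_
  rw [← add_div]
  exact div_le_div_of_nonneg_right (by linarith [hωc t (hIcc ht)]) (hpos ht).le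

end LogarithmicIntegral

namespace RadialWeight

/-- The weight in logarithmic coordinates: the function `x ↦ log w(eˣ)`, whose convexity is the
log-convexity of `w`. -/
noncomputable def logProfile (w : RadialWeight) (x : ℝ) : ℝ := Real.log (w (Real.exp x))

theorem exp_logProfile_log (w : RadialWeight) {r : ℝ} (hr : 0 < r) :
    Real.exp (w.logProfile (Real.log r)) = w r := by
  rw [logProfile, Real.exp_log hr, Real.exp_log (w.pos r hr.le)]

theorem log_apply_zero_le_logProfile (w : RadialWeight) (x : ℝ) :
    Real.log (w 0) ≤ w.logProfile x :=
  Real.log_le_log (w.pos 0 le_rfl)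
    (w.monotoneOn self_mem_Ici (Real.exp_pos x).le (Real.exp_pos x).le)

theorem isLittleO_logProfile (w : RadialWeight) : (fun x => x) =o[atTop] w.logProfile :=
  (w.log_isLittleO.comp_tendsto Real.tendsto_exp_atTop).congr_left Real.log_exp

theorem log_sub_log_eq_integral {w : RadialWeight} {ω : ℝ → ℝ} (hω : MonotoneOn ω (Ici 1))
    (hw : ∀ r, 1 ≤ r → w r = w 1 * Real.exp (∫ ρ in (1 : ℝ)..r, ω ρ / ρ)) {a b : ℝ}
    (ha : 1 ≤ a) (hb : 1 ≤ b) : Real.log (w b) - Real.log (w a) = ∫ ρ in a..b, ω ρ / ρ := by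
  have hlog {r : ℝ} (hr : 1 ≤ r) :
      Real.log (w r) = Real.log (w 1) + ∫ ρ in (1 : ℝ)..r, ω ρ / ρ := by
    rw [hw r hr, Real.log_mul (w.pos 1 zero_le_one).ne' (Real.exp_ne_zero _), Real.log_exp]
  have hint {r : ℝ} (hr : 1 ≤ r) : IntervalIntegrable (fun ρ => ω ρ / ρ) volume 1 r := by
    have huIcc : uIcc 1 r ⊆ Ici 1 := uIcc_of_le hr ▸ Icc_subset_Ici_self
    exact intervalIntegrable_div_id_of_monotoneOn (hω.mono huIcc)
      fun h => zero_lt_one.not_ge (mem_Ici.1 (huIcc h))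
  rw [hlog ha, hlog hb, add_sub_add_left_eq_sub,
    intervalIntegral.integral_interval_sub_left (hint hb) (hint ha)]

theorem IsClunieKovari.exists_monotoneOn_logProfile {w : RadialWeight} (hw : w.IsClunieKovari) :
    ∃ d, 0 ≤ d ∧ MonotoneOn (fun y => w.logProfile (y + d) - w.logProfile y - y) (Ici 0) := by
  obtain ⟨-, ω, hω, -, hrep, c, hc, hωc⟩ := hw
  refine ⟨Real.log c, Real.log_nonneg hc.le, fun y hy z hz hyz => ?_⟩
  have hshift (x : ℝ) : Real.exp (x + Real.log c) = c * Real.exp x := by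
    rw [Real.exp_add, Real.exp_log (by linarith), mul_comm]
  have hexp {x : ℝ} (hx : x ∈ Ici 0) : 1 ≤ Real.exp x := Real.one_le_exp hx
  have hgrowth := integral_div_id_add_log_le hω hc hωc (hexp hy) (Real.exp_le_exp.2 hyz)
  rw [← log_sub_log_eq_integral hω hrep (hexp hy) (hexp hz), ← log_sub_log_eq_integral hω hrep
    (one_le_mul_of_one_le_of_one_le hc.le (hexp hy))
    (one_le_mul_of_one_le_of_one_le hc.le (hexp hz)), Real.log_exp, Real.log_exp] at hgrowth
  simp only [logProfile, hshift]
  linarith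

theorem IsClunieKovari.nonempty_supportingLines {w : RadialWeight} (hw : w.IsClunieKovari) :
    Nonempty (SupportingLines w.logProfile) := by
  obtain ⟨d, hd, hmono⟩ := hw.exists_monotoneOn_logProfile
  exact SupportingLines.nonempty_of_monotoneOn hw.1 w.log_apply_zero_le_logProfile
    w.isLittleO_logProfile hd hmono

theorem lacunarySeries_mem_subspace {w : RadialWeight} (S : SupportingLines w.logProfile) :
    S.lacunarySeries ∈ w.subspace := by
  refine ⟨S.differentiable_lacunarySeries, max (‖S.lacunarySeries 0‖ / w 0) 4,
    forall_mem_range.2 fun z => ?_⟩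
  rcases eq_or_ne z 0 with rfl | hz
  · rw [norm_zero (E := ℂ)]
    exact le_max_left _ _
  · refine le_max_of_le_right ((div_le_iff₀ (w.pos_norm z)).2 ?_)
    simpa only [w.exp_logProfile_log (norm_pos_iff.2 hz)] using S.norm_lacunarySeries_le hz

theorem IsClunieKovari.exists_le_re {w : RadialWeight} (hw : w.IsClunieKovari) :
    ∃ f : w.H, ∀ᶠ r : ℝ in atTop, w r ≤ (f r).re := by
  obtain ⟨S⟩ := hw.nonempty_supportingLines
  set A := Real.exp (2 * Real.log 2 + 2 * S.D)
  refine ⟨⟨(A : ℂ) • S.lacunarySeries, w.subspace.smul_mem A (lacunarySeries_mem_subspace S)⟩, ?_⟩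
  filter_upwards [eventually_ge_atTop (Real.exp (S.x 0))] with r hr
  have hr₀ : 0 < r := (Real.exp_pos _).trans_le hr
  have hwr := S.exp_le_mul_tsum_term ((Real.le_log_iff_exp_le hr₀).2 hr)
  rwa [w.exp_logProfile_log hr₀, ← S.re_lacunarySeries hr₀, ← Complex.re_ofReal_mul] at hwr

end RadialWeight

theorem mainTheorem9_general (w v : RadialWeight)
    (hw : ∃ f : w.H, ∀ᶠ r : ℝ in atTop, w r ≤ (f r).re) :
    (∃ T : w.H →L[ℂ] v.H, ∀ (f : w.H) (z : ℂ), T f z = integrationOperator f z) ↔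
      Filter.limsup (fun r : ℝ => (((1 / v r) * ∫ t in (0 : ℝ)..r, w t : ℝ) : EReal))
        Filter.atTop < ⊤ := by
  rw [limsup_coe_lt_top_iff]
  constructor
  · rintro ⟨T, hT⟩
    obtain ⟨f, hf⟩ := hw
    exact RadialWeight.isBoundedUnder_of_le_re f.2.1.continuous hf (hT f)
  · intro h
    obtain ⟨C, hC⟩ := RadialWeight.exists_forall_integral_le_of_isBoundedUnder h
    exact RadialWeight.exists_continuousLinearMap_of_integral_le hC

/-- For a Clunie–Kővári weight `w` and any radial weight `v` on `ℂ`, the integration operator is a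
continuous linear operator `H_w(ℂ) → H_v(ℂ)` iff `limsup_{r → ∞} (1 / v(r)) ∫₀ʳ w(t) dt < ∞`. -/
theorem mainTheorem9 (w v : RadialWeight) (hw : w.IsClunieKovari) :
    (∃ T : w.H →L[ℂ] v.H, ∀ (f : w.H) (z : ℂ), T f z = integrationOperator f z) ↔
      Filter.limsup (fun r : ℝ => (((1 / v r) * ∫ t in (0 : ℝ)..r, w t : ℝ) : EReal))
        Filter.atTop < ⊤ :=
  mainTheorem9_general w v hw.exists_le_re
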